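/- Let $G$ be a locally compact Hausdorff group, $N$ a closed normal subgroup, and let $\lambda_G,\lambda_N,\lambda_{G/N}$ be left Haar (Radon) measures normalized by Weil's formula $\int_{G/N}\int_N f(xs)\,d\lambda_N(s)\,d\lambda_{G/N}(xN)=\int_G f\,d\lambda_G$ for $f\in\mathcal C_c(G)$. Let $\xi\in\Gamma(G,N)$, i.e. $\xi:N\to\mathbb T$ is a continuous homomorphism with $\xi(x^{-1}sx)=\xi(s)$ for all $x\in G$, $s\in N$, and let $1\le p<\infty$. A function $\psi:G\to\mathbb C$ is called covariant if $\psi(xs)=\xi(s)\psi(x)$ for all $x\in G$, $s\in N$. Let $\mathcal C_\xi(G,N)$ be the space of continuous covariant functions $\psi$ such that the image of $\operatorname{supp}\psi$ in $G/N$ is compact, with the norms $\|\psi\|_{(p)}=\left(\int_{G/N}|\psi(y)|^p\,d\lambda_{G/N}(yN)\right)^{1/p}$, and let $L^p_\xi(G,N)$ be the Banach completion of $(\mathcal C_\xi(G,N),\|\cdot\|_{(p)})$. Elements of $L^p_\xi(G,N)$ are represented by functions on $G$: a covariant function $f:G\to\mathbb C$ represents $F\in L^p_\xi(G,N)$ if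 there are $u_n\in\mathcal C_\xi(G,N)$ with $u_n\to F$ in $L^p_\xi(G,N)$, such that the functions $yN\mapsto|f(y)-u_n(y)|$ are $\lambda_{G/N}$-measurable and $\int_{G/N}|f(y)-u_n(y)|^p\,d\lambda_{G/N}(yN)\to0$. For $\phi,\psi\in\mathcal C_\xi(G,N)$ put $\phi\natural\psi(x)=\int_{G/N}\phi(y)\psi(y^{-1}x)\,d\lambda_{G/N}(yN)$; this belongs to $\mathcal C_\xi(G,N)$, and $\natural$ extends uniquely to a continuous bilinear map $\natural:L^1_\xi(G,N)\times L^p_\xi(G,N)\to L^p_\xi(G,N)$. Theorem. Let $\Phi\in L^1_\xi(G,N)$ and $\Psi\in L^p_\xi(G,N)$. Then $\Phi$, $\Psi$ and $\Phi\natural\Psi$ are represented by functions on $G$, and for all functions $\phi,\psi,\chi$ on $G$ representing $\Phi$, $\Psi$ and $\Phi\natural\Psi$ respectively, for locally almost every $x\in G$ (that is, for all $x$ outside a set meeting every compact set in a $\lambda_G$-null set) the function $yN\mapsto\phi(y)\psi(y^{-1}x)$ is integrable on $G/N$ and $$\chi(x)=\int_{G/N}\phi(y)\psi(y^{-1}x)\,d\lambda_{G/N}(yN).$$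 -/

import Mathlib

open MeasureTheory Filter Topology
open scoped ENNReal

namespace CovariantFunctions

noncomputable section

section Descend

variable {G : Type*} [Group G] {E : Type*}

/-- The function on `G ⧸ N` induced by a function on `G` that is constant on the cosets `xN`
(see `descend_mk`). -/
def descend (N : Subgroup G) (F : G → E) : G ⧸ N → E := fun z => F z.out

theorem descend_mk {N : Subgroup G} {F : G → E} (hF : ∀ (x : G) (s : N), F (x * s) = F x)
    (x : G) : descend N F (x : G ⧸ N) = F x := by
  obtain ⟨s, hs⟩ := QuotientGroup.mk_out_eq_mul N x
  simp [descend, hs, hF]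

end Descend

section Covariant

variable {G : Type*} [Group G] [TopologicalSpace G] {N : Subgroup G}

/-- `ψ (x s) = ξ(s) ψ(x)` for all `x ∈ G`, `s ∈ N`. -/
def IsCovariant (ξ : N →ₜ* Circle) (ψ : G → ℂ) : Prop :=
  ∀ (x : G) (s : N), ψ (x * s) = (ξ s : ℂ) * ψ x

/-- The set `Γ(G,N)` of the `G`-invariant characters of `N`. -/
def invariantCharacters (N : Subgroup G) [N.Normal] : Set (N →ₜ* Circle) :=
  {ξ | ∀ (x : G) (s : N),
    ξ ⟨x⁻¹ * (s : G) * x, Subgroup.Normal.conj_mem' inferInstance (s : G) s.2 x⟩ = ξ s}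

theorem IsCovariant.norm_eq {ξ : N →ₜ* Circle} {ψ : G → ℂ} (h : IsCovariant ξ ψ) (x : G) (s : N) :
    ‖ψ (x * s)‖ = ‖ψ x‖ := by
  rw [h x s, norm_mul, Circle.norm_coe, one_mul]

theorem IsCovariant.inv_mul {ξ : N →ₜ* Circle} [N.Normal] (hξ : ξ ∈ invariantCharacters N)
    {φ ψ : G → ℂ} (hφ : IsCovariant ξ φ) (hψ : IsCovariant ξ ψ) (x y : G) (s : N) :
    φ (y * s) * ψ ((y * s)⁻¹ * x) = φ y * ψ (y⁻¹ * x) := by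
  have h1 : (y * (s : G))⁻¹ * x = y⁻¹ * x *
      ((⟨(y⁻¹ * x)⁻¹ * ((s⁻¹ : N) : G) * (y⁻¹ * x),
        Subgroup.Normal.conj_mem' inferInstance _ (s⁻¹ : N).2 _⟩ : N) : G) := by
    simp only [InvMemClass.coe_inv]
    group
  rw [h1, hφ, hψ, hξ (y⁻¹ * x) s⁻¹, map_inv, Circle.coe_inv]
  have : (ξ s : ℂ) ≠ 0 := Circle.coe_ne_zero _
  field_simp

variable [IsTopologicalGroup G]

theorem image_mk_tsupport_isClosed {ξ : N →ₜ* Circle} {ψ : G → ℂ} (hψ : IsCovariant ξ ψ) :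
    IsClosed ((↑) '' tsupport ψ : Set (G ⧸ N)) := by
  rw [← (QuotientGroup.isQuotientMap_mk N).isClosed_preimage]
  convert isClosed_tsupport ψ using 1
  refine Set.Subset.antisymm ?_ (Set.subset_preimage_image _ _)
  rintro x ⟨y, hy, hxy⟩
  obtain ⟨s, hs, rfl⟩ : ∃ s ∈ N, y * s = x :=
    ⟨y⁻¹ * x, QuotientGroup.eq.1 hxy, by group⟩
  have hpre : (fun t : G => t * s) ⁻¹' Function.support ψ = Function.support ψ := by
    ext t
    have := hψ.norm_eq t ⟨s, hs⟩
    simp only [Set.mem_preimage, Function.mem_support, ne_eq, ← norm_eq_zero (E := ℂ)]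
    rw [this]
  have h2 : (fun t : G => t * s) ⁻¹' tsupport ψ = tsupport ψ := by
    unfold tsupport
    rw [← Homeomorph.coe_mulRight, Homeomorph.preimage_closure, Homeomorph.coe_mulRight, hpre]
  change y ∈ (fun t : G => t * s) ⁻¹' tsupport ψ
  rwa [h2]

/-- The space `𝒞_ξ(G,N)` of the continuous covariant functions of `ξ` whose support has compact
image in `G ⧸ N`. -/
def covariantSubmodule (ξ : N →ₜ* Circle) [IsClosed (N : Set G)] [N.Normal] :
    Submodule ℂ (G → ℂ) where
  carrier := {ψ | Continuous ψ ∧ IsCompact ((↑) '' tsupport ψ : Set (G ⧸ N)) ∧ IsCovariant ξ ψ}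
  zero_mem' := ⟨continuous_const, by simp [tsupport], fun x s => by simp⟩
  add_mem' := by
    rintro f g ⟨hf, hfc, hfξ⟩ ⟨hg, hgc, hgξ⟩
    have hcov : IsCovariant ξ (f + g) := fun x s => by
      simp only [Pi.add_apply, hfξ x s, hgξ x s]; ring
    refine ⟨hf.add hg, (hfc.union hgc).of_isClosed_subset (image_mk_tsupport_isClosed hcov) ?_,
      hcov⟩
    rw [← Set.image_union]
    exact Set.image_mono (tsupport_add f g)
  smul_mem' := by
    rintro c f ⟨hf, hfc, hfξ⟩
    have hcov : IsCovariant ξ (c • f) := fun x s => by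
      simp only [Pi.smul_apply, hfξ x s, smul_eq_mul]; ring
    refine ⟨hf.const_smul c, hfc.of_isClosed_subset (image_mk_tsupport_isClosed hcov)
      (Set.image_mono ?_), hcov⟩
    exact closure_mono (Function.support_const_smul_subset c f)

end Covariant

section Norm

variable {G : Type*} [Group G] [TopologicalSpace G] [IsTopologicalGroup G]
  {N : Subgroup G} [N.Normal] [IsClosed (N : Set G)]
  [MeasurableSpace (G ⧸ N)]

/-- `𝒞_ξ(G,N)`, to be normed by `‖·‖_(p)` with respect to the measure `μ` on `G ⧸ N`. -/
def CovFun (ξ : N →ₜ* Circle) (_μ : Measure (G ⧸ N)) (_p : ℝ≥0∞) : Type _ :=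
  covariantSubmodule ξ

variable {ξ : N →ₜ* Circle} {μ : Measure (G ⧸ N)} {p : ℝ≥0∞}

instance : AddCommGroup (CovFun ξ μ p) := inferInstanceAs (AddCommGroup (covariantSubmodule ξ))

instance : Module ℂ (CovFun ξ μ p) := inferInstanceAs (Module ℂ (covariantSubmodule ξ))

instance : CoeFun (CovFun ξ μ p) (fun _ => G → ℂ) := ⟨fun ψ => ψ.1⟩

namespace CovFun

theorem add_apply (φ ψ : CovFun ξ μ p) (x : G) : (φ + ψ) x = φ x + ψ x := rfl

theorem smul_apply (c : ℂ) (ψ : CovFun ξ μ p) (x : G) : (c • ψ) x = c * ψ x := rfl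

protected theorem ext {φ ψ : CovFun ξ μ p} (h : ∀ x, φ x = ψ x) : φ = ψ := Subtype.ext (funext h)

protected theorem continuous (ψ : CovFun ξ μ p) : Continuous ψ := ψ.2.1

theorem isCompact (ψ : CovFun ξ μ p) : IsCompact ((↑) '' tsupport ψ : Set (G ⧸ N)) := ψ.2.2.1

theorem isCovariant (ψ : CovFun ξ μ p) : IsCovariant ξ ψ := ψ.2.2.2

/-- The function `xN ↦ |ψ(x)|`. -/
def absQ (ψ : CovFun ξ μ p) : G ⧸ N → ℝ := descend N fun x => ‖ψ x‖

theorem absQ_mk (ψ : CovFun ξ μ p) (x : G) : absQ ψ (x : G ⧸ N) = ‖ψ x‖ :=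
  descend_mk (F := fun x => ‖ψ x‖) ψ.isCovariant.norm_eq x

theorem absQ_nonneg (ψ : CovFun ξ μ p) (z : G ⧸ N) : 0 ≤ absQ ψ z := norm_nonneg _

theorem continuous_absQ (ψ : CovFun ξ μ p) : Continuous (absQ ψ) := by
  rw [(QuotientGroup.isQuotientMap_mk N).continuous_iff]
  have : absQ ψ ∘ (QuotientGroup.mk : G → G ⧸ N) = fun x => ‖ψ x‖ := funext (absQ_mk ψ)
  rw [this]
  exact ψ.continuous.norm

theorem absQ_eq_zero (ψ : CovFun ξ μ p) {z : G ⧸ N} (hz : z ∉ ((↑) '' tsupport ψ : Set (G ⧸ N))) :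
    absQ ψ z = 0 := by
  induction z using QuotientGroup.induction_on with | _ x
  rw [absQ_mk, image_eq_zero_of_notMem_tsupport (fun h => hz ⟨x, h, rfl⟩), norm_zero]

theorem hasCompactSupport_absQ (ψ : CovFun ξ μ p) : HasCompactSupport (absQ ψ) :=
  HasCompactSupport.intro ψ.isCompact fun _ hz => absQ_eq_zero ψ hz

end CovFun

end Norm

section NormInst

variable {G : Type*} [Group G] [TopologicalSpace G] [IsTopologicalGroup G]
  {N : Subgroup G} [N.Normal] [IsClosed (N : Set G)]
  [MeasurableSpace (G ⧸ N)] [BorelSpace (G ⧸ N)]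
  {ξ : N →ₜ* Circle} {μ : Measure (G ⧸ N)} [μ.IsHaarMeasure] {p : ℝ≥0∞}

theorem CovFun.memLp (ψ : CovFun ξ μ p) (q : ℝ≥0∞) : MemLp (CovFun.absQ ψ) q μ :=
  ψ.continuous_absQ.memLp_of_hasCompactSupport ψ.hasCompactSupport_absQ

/-- `‖ψ‖_(p) = (∫_{G/N} |ψ(y)|^p dμ(yN))^{1/p}`. -/
instance : Norm (CovFun ξ μ p) := ⟨fun ψ => (eLpNorm (descend N fun x => ‖ψ x‖) p μ).toReal⟩

theorem CovFun.norm_def (ψ : CovFun ξ μ p) : ‖ψ‖ = (eLpNorm (CovFun.absQ ψ) p μ).toReal := rfl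

variable [hp : Fact (1 ≤ p)]

theorem CovFun.normCore : NormedSpace.Core ℂ (CovFun ξ μ p) where
  norm_nonneg ψ := ENNReal.toReal_nonneg
  norm_smul c ψ := by
    have : CovFun.absQ (c • ψ) = ‖c‖ • CovFun.absQ ψ := by
      ext z
      simp [CovFun.absQ, descend, CovFun.smul_apply]
    rw [CovFun.norm_def, this, eLpNorm_const_smul, ENNReal.toReal_mul, CovFun.norm_def]
    simp
  norm_triangle φ ψ := by
    simp only [CovFun.norm_def]
    rw [← ENNReal.toReal_add (φ.memLp p).eLpNorm_ne_top (ψ.memLp p).eLpNorm_ne_top]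
    refine ENNReal.toReal_mono (ENNReal.add_ne_top.2
      ⟨(φ.memLp p).eLpNorm_ne_top, (ψ.memLp p).eLpNorm_ne_top⟩) ?_
    refine le_trans (eLpNorm_mono_real (g := CovFun.absQ φ + CovFun.absQ ψ) fun z => ?_)
      (eLpNorm_add_le (φ.memLp p).aestronglyMeasurable (ψ.memLp p).aestronglyMeasurable hp.out)
    rw [Real.norm_of_nonneg (CovFun.absQ_nonneg _ _)]
    exact norm_add_le _ _
  norm_eq_zero_iff ψ := by
    constructor
    · intro h
      rw [CovFun.norm_def, ENNReal.toReal_eq_zero_iff,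
        or_iff_left (ψ.memLp p).eLpNorm_ne_top,
        eLpNorm_eq_zero_iff (ψ.memLp p).aestronglyMeasurable
          (zero_lt_one.trans_le hp.out).ne'] at h
      have h0 := Continuous.ae_eq_iff_eq μ ψ.continuous_absQ continuous_const |>.1 h
      refine CovFun.ext fun x => ?_
      have := congrFun h0 (x : G ⧸ N)
      rw [CovFun.absQ_mk] at this
      exact norm_eq_zero.1 this
    · rintro rfl
      have : CovFun.absQ (0 : CovFun ξ μ p) = 0 := by
        ext z
        exact norm_zero
      rw [CovFun.norm_def, this]
      simp

instance : NormedAddCommGroup (CovFun ξ μ p) := NormedAddCommGroup.ofCore CovFun.normCore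

instance : NormedSpace ℂ (CovFun ξ μ p) := NormedSpace.ofCore CovFun.normCore

end NormInst

section Convolution

variable {G : Type*} [Group G] [TopologicalSpace G] [IsTopologicalGroup G]
  {N : Subgroup G} [N.Normal] [IsClosed (N : Set G)]
  [MeasurableSpace (G ⧸ N)]

/-- The covariant convolution `φ ♮ ψ (x) = ∫_{G/N} φ(y) ψ(y⁻¹ x) dμ(yN)`. -/
def covConv (μ : Measure (G ⧸ N)) (φ ψ : G → ℂ) (x : G) : ℂ :=
  ∫ z, descend N (fun y => φ y * ψ (y⁻¹ * x)) z ∂μ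

variable [BorelSpace (G ⧸ N)] {ξ : N →ₜ* Circle} {μ : Measure (G ⧸ N)} [μ.IsHaarMeasure]
  {p q : ℝ≥0∞}

theorem continuous_integrand (hξ : ξ ∈ invariantCharacters N) (φ : CovFun ξ μ q)
    (ψ : CovFun ξ μ p) :
    Continuous fun w : G × (G ⧸ N) => descend N (fun y => φ y * ψ (y⁻¹ * w.1)) w.2 := by
  rw [← (IsOpenQuotientMap.id.prodMap
    (QuotientGroup.isOpenQuotientMap_mk (N := N))).continuous_comp_iff]
  have : (fun w : G × (G ⧸ N) => descend N (fun y => φ y * ψ (y⁻¹ * w.1)) w.2) ∘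
      Prod.map id (QuotientGroup.mk : G → G ⧸ N) =
      fun w : G × G => φ w.2 * ψ (w.2⁻¹ * w.1) := by
    ext w
    exact descend_mk (F := fun y => φ y * ψ (y⁻¹ * w.1))
      (fun y s => IsCovariant.inv_mul hξ φ.isCovariant ψ.isCovariant w.1 y s) w.2
  rw [this]
  have h1 := φ.continuous
  have h2 := ψ.continuous
  exact (h1.comp continuous_snd).mul (h2.comp (continuous_snd.inv.mul continuous_fst))

theorem integrand_eq_zero (φ : CovFun ξ μ q) (ψ : CovFun ξ μ p) (x : G) {z : G ⧸ N}
    (hz : z ∉ ((↑) '' tsupport φ : Set (G ⧸ N))) :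
    descend N (fun y => φ y * ψ (y⁻¹ * x)) z = 0 := by
  have : ‖φ z.out‖ = 0 := CovFun.absQ_eq_zero φ hz
  simp [descend, norm_eq_zero.1 this]

theorem norm_integrand (φ : CovFun ξ μ q) (ψ : CovFun ξ μ p) (x : G) (z : G ⧸ N) :
    ‖descend N (fun y => φ y * ψ (y⁻¹ * x)) z‖ = φ.absQ z * ψ.absQ (z⁻¹ * (x : G ⧸ N)) := by
  have : z⁻¹ * (x : G ⧸ N) = ((z.out⁻¹ * x : G) : G ⧸ N) := by
    rw [QuotientGroup.mk_mul, QuotientGroup.mk_inv, QuotientGroup.out_eq']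
  rw [this, CovFun.absQ_mk, descend, norm_mul]
  rfl

theorem integrable_integrand (hξ : ξ ∈ invariantCharacters N) (φ : CovFun ξ μ q)
    (ψ : CovFun ξ μ p) (x : G) :
    Integrable (fun z => descend N (fun y => φ y * ψ (y⁻¹ * x)) z) μ :=
  ((continuous_integrand hξ φ ψ).comp (Continuous.prodMk_right x)).integrable_of_hasCompactSupport
    (HasCompactSupport.intro φ.isCompact fun _ hz => integrand_eq_zero φ ψ x hz)

/-- The covariant convolution maps `𝒞_ξ(G,N) × 𝒞_ξ(G,N)` to `𝒞_ξ(G,N)`. -/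
theorem covConv_mem (hξ : ξ ∈ invariantCharacters N) (φ : CovFun ξ μ q) (ψ : CovFun ξ μ p) :
    covConv μ φ ψ ∈ covariantSubmodule ξ := by
  have hcov : IsCovariant ξ (covConv μ φ ψ) := fun x s => by
    unfold covConv
    rw [← integral_const_mul]
    congr 1
    ext z
    simp only [descend]
    rw [← mul_assoc, ψ.isCovariant]
    ring
  refine ⟨?_, ?_, hcov⟩
  · rw [← continuousOn_univ]
    refine continuousOn_integral_of_compact_support
      (f := fun x z => descend N (fun y => φ y * ψ (y⁻¹ * x)) z) φ.isCompact
      (continuous_integrand hξ φ ψ).continuousOn ?_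
    intro x z _ hz
    exact integrand_eq_zero φ ψ x hz
  · have hK := φ.isCompact.mul ψ.isCompact
    refine hK.of_isClosed_subset (image_mk_tsupport_isClosed hcov) ?_
    rw [Set.image_subset_iff]
    refine closure_minimal ?_ (hK.isClosed.preimage QuotientGroup.continuous_mk)
    intro x hx
    by_contra hne
    refine hx (integral_eq_zero_of_ae (Eventually.of_forall fun z => ?_))
    change descend N (fun y => φ y * ψ (y⁻¹ * x)) z = 0
    rw [← norm_eq_zero, norm_integrand]
    by_cases hz : z ∈ ((↑) '' tsupport φ : Set (G ⧸ N))
    · rw [CovFun.absQ_eq_zero ψ, mul_zero]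
      intro h
      exact hne ⟨z, hz, _, h, by group⟩
    · rw [CovFun.absQ_eq_zero φ hz, zero_mul]

/-- `φ ♮ ψ` as an element of `𝒞_ξ(G,N)`. -/
def CovFun.conv (hξ : ξ ∈ invariantCharacters N) (φ : CovFun ξ μ q) (ψ : CovFun ξ μ p) :
    CovFun ξ μ p := ⟨covConv μ φ ψ, covConv_mem hξ φ ψ⟩

open scoped Pointwise in
theorem lintegral_conv_rpow_le {a b : G ⧸ N → ℝ} (ha : Continuous a) (hb : Continuous b)
    (ha' : HasCompactSupport a) (hb' : HasCompactSupport b) (ha0 : ∀ z, 0 ≤ a z)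
    (hb0 : ∀ z, 0 ≤ b z) {r : ℝ} (hr : 1 ≤ r) :
    ∫⁻ w, (∫⁻ z, ENNReal.ofReal (a z) * ENNReal.ofReal (b (z⁻¹ * w)) ∂μ) ^ r ∂μ ≤
      (∫⁻ z, ENNReal.ofReal (a z) ∂μ) ^ r * ∫⁻ z, ENNReal.ofReal (b z) ^ r ∂μ := by
  have hr0 : 0 < r := zero_lt_one.trans_le hr
  set A := ∫⁻ z, ENNReal.ofReal (a z) ∂μ with hA
  set B := ∫⁻ z, ENNReal.ofReal (b z) ^ r ∂μ with hB
  have hbr : Continuous fun z => b z ^ r := hb.rpow_const fun _ => Or.inr hr0.le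
  have hf : Continuous (Function.uncurry fun w z : G ⧸ N => a z * b (z⁻¹ * w) ^ r) :=
    (ha.comp continuous_snd).mul (hbr.comp (continuous_snd.inv.mul continuous_fst))
  have hzero : ∀ w z, ¬ (w ∈ tsupport a * tsupport b ∧ z ∈ tsupport a) →
      a z * b (z⁻¹ * w) ^ r = 0 := by
    intro w z hwz
    by_cases hz : z ∈ tsupport a
    · rw [image_eq_zero_of_notMem_tsupport (f := b), Real.zero_rpow hr0.ne', mul_zero]
      intro h
      exact hwz ⟨⟨z, hz, _, h, by group⟩, hz⟩
    · rw [image_eq_zero_of_notMem_tsupport hz, zero_mul]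
  have hfc : HasCompactSupport
      (Function.uncurry fun w z : G ⧸ N => a z * b (z⁻¹ * w) ^ r) :=
    HasCompactSupport.intro
      ((ha'.isCompact.mul hb'.isCompact).prod ha'.isCompact) fun x hx => hzero x.1 x.2 hx
  have hpos : ∀ w z, 0 ≤ a z * b (z⁻¹ * w) ^ r := fun w z =>
    mul_nonneg (ha0 z) (Real.rpow_nonneg (hb0 _) r)
  have hbc : HasCompactSupport fun z => b z ^ r :=
    hb'.mono fun z hz h => hz (by simp only [h, Real.zero_rpow hr0.ne'])
  have hint1 : ∀ w, Integrable (fun z => a z * b (z⁻¹ * w) ^ r) μ := fun w =>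
    (hf.comp (Continuous.prodMk_right w)).integrable_of_hasCompactSupport
      (ha'.mono fun z hz h => hz (by simp [h]))
  have hint2 : ∀ z, Integrable (fun w => a z * b (z⁻¹ * w) ^ r) μ := fun z =>
    ((hbr.integrable_of_hasCompactSupport hbc).comp_mul_left z⁻¹).const_mul (a z)
  have hIcont : Continuous fun w => ∫ z, a z * b (z⁻¹ * w) ^ r ∂μ := by
    rw [← continuousOn_univ]
    refine continuousOn_integral_of_compact_support
      (f := fun w z => a z * b (z⁻¹ * w) ^ r) ha'.isCompact hf.continuousOn ?_
    intro w z _ hz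
    rw [image_eq_zero_of_notMem_tsupport hz, zero_mul]
  have hIint : Integrable (fun w => ∫ z, a z * b (z⁻¹ * w) ^ r ∂μ) μ := by
    refine hIcont.integrable_of_hasCompactSupport
      (HasCompactSupport.intro (ha'.isCompact.mul hb'.isCompact) fun w hw => ?_)
    refine integral_eq_zero_of_ae (Eventually.of_forall fun z => ?_)
    exact hzero w z fun h => hw h.1
  have hofReal : ∀ w z, ENNReal.ofReal (a z * b (z⁻¹ * w) ^ r) =
      ENNReal.ofReal (a z) * ENNReal.ofReal (b (z⁻¹ * w)) ^ r := fun w z => by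
    rw [ENNReal.ofReal_mul (ha0 z), ENNReal.ofReal_rpow_of_nonneg (hb0 _) hr0.le]
  have hswap : ∫⁻ w, ∫⁻ z, ENNReal.ofReal (a z) * ENNReal.ofReal (b (z⁻¹ * w)) ^ r ∂μ ∂μ =
      A * B := by
    have h1 : ∀ w, ∫⁻ z, ENNReal.ofReal (a z) * ENNReal.ofReal (b (z⁻¹ * w)) ^ r ∂μ =
        ENNReal.ofReal (∫ z, a z * b (z⁻¹ * w) ^ r ∂μ) := fun w => by
      rw [ofReal_integral_eq_lintegral_ofReal (hint1 w) (Eventually.of_forall (hpos w))]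
      simp only [hofReal]
    simp only [h1]
    rw [← ofReal_integral_eq_lintegral_ofReal hIint
      (Eventually.of_forall fun w => integral_nonneg (hpos w)),
      integral_integral_swap_of_hasCompactSupport hf hfc]
    have h2 : ∀ z, ∫ w, a z * b (z⁻¹ * w) ^ r ∂μ = a z * ∫ w, b w ^ r ∂μ := fun z => by
      rw [integral_const_mul, integral_mul_left_eq_self (fun w => b w ^ r) z⁻¹]
    simp only [h2]
    rw [integral_mul_const, ENNReal.ofReal_mul (integral_nonneg ha0),
      ofReal_integral_eq_lintegral_ofReal (ha.integrable_of_hasCompactSupport ha')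
        (Eventually.of_forall ha0),
      ofReal_integral_eq_lintegral_ofReal (hbr.integrable_of_hasCompactSupport hbc)
        (Eventually.of_forall fun z => Real.rpow_nonneg (hb0 z) r), hA, hB]
    congr 2
    ext z
    rw [ENNReal.ofReal_rpow_of_nonneg (hb0 _) hr0.le]
  have hr1 : 0 ≤ 1 - 1 / r := by
    rw [sub_nonneg, div_le_one hr0]; exact hr
  have hinner : ∀ w, (∫⁻ z, ENNReal.ofReal (a z) * ENNReal.ofReal (b (z⁻¹ * w)) ∂μ) ^ r ≤
      A ^ (r - 1) * ∫⁻ z, ENNReal.ofReal (a z) * ENNReal.ofReal (b (z⁻¹ * w)) ^ r ∂μ := by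
    intro w
    have hbm : Continuous fun z => b (z⁻¹ * w) := hb.comp (continuous_inv.mul continuous_const)
    have hm1 : Measurable fun z => ENNReal.ofReal (a z) :=
      ENNReal.measurable_ofReal.comp ha.measurable
    have hm2 : Measurable fun z => ENNReal.ofReal (b (z⁻¹ * w)) :=
      ENNReal.measurable_ofReal.comp hbm.measurable
    have h := ENNReal.lintegral_mul_norm_pow_le (μ := μ) hm1.aemeasurable
      (hm1.mul (hm2.pow_const r)).aemeasurable hr1 (by positivity : 0 ≤ 1 / r) (by ring)
    have heq : ∀ z, ENNReal.ofReal (a z) ^ (1 - 1 / r) *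
        (ENNReal.ofReal (a z) * ENNReal.ofReal (b (z⁻¹ * w)) ^ r) ^ (1 / r) =
        ENNReal.ofReal (a z) * ENNReal.ofReal (b (z⁻¹ * w)) := fun z => by
      rw [ENNReal.mul_rpow_of_nonneg _ _ (by positivity), ← ENNReal.rpow_mul, mul_one_div_cancel
        hr0.ne', ENNReal.rpow_one, ← mul_assoc, ← ENNReal.rpow_add_of_nonneg _ _ hr1
        (by positivity), sub_add_cancel, ENNReal.rpow_one]
    simp only [Pi.mul_apply, heq] at h
    refine (ENNReal.rpow_le_rpow h hr0.le).trans (le_of_eq ?_)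
    rw [ENNReal.mul_rpow_of_nonneg _ _ hr0.le, ← ENNReal.rpow_mul, ← ENNReal.rpow_mul,
      one_div_mul_cancel hr0.ne', ENNReal.rpow_one, sub_mul, one_div_mul_cancel hr0.ne', one_mul]
  have hAtop : A ≠ ∞ := by
    rw [hA, ← ofReal_integral_eq_lintegral_ofReal (ha.integrable_of_hasCompactSupport ha')
        (Eventually.of_forall ha0)]
    exact ENNReal.ofReal_ne_top
  calc _ ≤ ∫⁻ w, A ^ (r - 1) *
        ∫⁻ z, ENNReal.ofReal (a z) * ENNReal.ofReal (b (z⁻¹ * w)) ^ r ∂μ ∂μ :=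
      lintegral_mono hinner
    _ = A ^ (r - 1) * (A * B) := by
      rw [lintegral_const_mul' _ _ (ENNReal.rpow_ne_top_of_nonneg (by linarith) hAtop), hswap]
    _ = A ^ r * B := by
      rw [← mul_assoc]
      congr 1
      nth_rewrite 2 [← ENNReal.rpow_one A]
      rw [← ENNReal.rpow_add_of_nonneg _ _ (by linarith) zero_le_one, sub_add_cancel]

theorem CovFun.norm_conv_le [Fact (1 ≤ p)] (hp : p ≠ ∞) (hξ : ξ ∈ invariantCharacters N)
    (φ : CovFun ξ μ 1) (ψ : CovFun ξ μ p) : ‖φ.conv hξ ψ‖ ≤ ‖φ‖ * ‖ψ‖ := by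
  have h1p : 1 ≤ p := Fact.out
  have hp0 : p ≠ 0 := (zero_lt_one.trans_le h1p).ne'
  have hr : 1 ≤ p.toReal := by
    rw [← ENNReal.toReal_one]; exact ENNReal.toReal_mono hp h1p
  have hr0 : 0 < p.toReal := zero_lt_one.trans_le hr
  simp only [CovFun.norm_def]
  rw [← ENNReal.toReal_mul]
  refine ENNReal.toReal_mono (ENNReal.mul_ne_top (φ.memLp 1).eLpNorm_ne_top
    (ψ.memLp p).eLpNorm_ne_top) ?_
  have hen : ∀ {q : ℝ≥0∞} (f : CovFun ξ μ q) z, ‖f.absQ z‖ₑ = ENNReal.ofReal (f.absQ z) :=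
    fun f z => Real.enorm_of_nonneg (f.absQ_nonneg z)
  rw [eLpNorm_one_eq_lintegral_enorm, eLpNorm_eq_lintegral_rpow_enorm_toReal hp0 hp,
    eLpNorm_eq_lintegral_rpow_enorm_toReal hp0 hp]
  simp only [hen]
  have key := lintegral_conv_rpow_le (μ := μ) φ.continuous_absQ ψ.continuous_absQ
    φ.hasCompactSupport_absQ ψ.hasCompactSupport_absQ φ.absQ_nonneg ψ.absQ_nonneg hr
  have hpt : ∀ w, ENNReal.ofReal ((φ.conv hξ ψ).absQ w) ≤
      ∫⁻ z, ENNReal.ofReal (φ.absQ z) * ENNReal.ofReal (ψ.absQ (z⁻¹ * w)) ∂μ := by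
    intro w
    induction w using QuotientGroup.induction_on with | _ x
    rw [CovFun.absQ_mk, ofReal_norm]
    refine (enorm_integral_le_lintegral_enorm _).trans (le_of_eq ?_)
    congr 1
    ext z
    rw [← ofReal_norm, norm_integrand, ENNReal.ofReal_mul (φ.absQ_nonneg z)]
  calc
    _ ≤ ((∫⁻ z, ENNReal.ofReal (φ.absQ z) ∂μ) ^ p.toReal *
        ∫⁻ z, ENNReal.ofReal (ψ.absQ z) ^ p.toReal ∂μ) ^ (1 / p.toReal) := by
      refine ENNReal.rpow_le_rpow (le_trans (lintegral_mono fun w => ?_) key) (by positivity)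
      exact ENNReal.rpow_le_rpow (hpt w) hr0.le
    _ = _ := by
      rw [ENNReal.mul_rpow_of_nonneg _ _ (by positivity), ← ENNReal.rpow_mul,
        mul_one_div_cancel hr0.ne', ENNReal.rpow_one]

/-- The covariant convolution as a bounded bilinear map on
`(𝒞_ξ(G,N), ‖·‖_(1)) × (𝒞_ξ(G,N), ‖·‖_(p))`. -/
def CovFun.convL [Fact (1 ≤ p)] (hp : p ≠ ∞) (hξ : ξ ∈ invariantCharacters N) :
    CovFun ξ μ 1 →L[ℂ] CovFun ξ μ p →L[ℂ] CovFun ξ μ p :=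
  LinearMap.mkContinuous₂
    (LinearMap.mk₂ ℂ (fun φ ψ => φ.conv hξ ψ)
      (fun φ₁ φ₂ ψ => CovFun.ext fun x => by
        refine Eq.trans ?_ (integral_add (integrable_integrand hξ φ₁ ψ x)
          (integrable_integrand hξ φ₂ ψ x))
        exact integral_congr_ae (Eventually.of_forall fun z => add_mul _ _ _))
      (fun c φ ψ => CovFun.ext fun x => by
        refine Eq.trans ?_ (integral_const_mul c _)
        exact integral_congr_ae (Eventually.of_forall fun z => mul_assoc _ _ _))
      (fun φ ψ₁ ψ₂ => CovFun.ext fun x => by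
        refine Eq.trans ?_ (integral_add (integrable_integrand hξ φ ψ₁ x)
          (integrable_integrand hξ φ ψ₂ x))
        exact integral_congr_ae (Eventually.of_forall fun z => mul_add _ _ _))
      (fun c φ ψ => CovFun.ext fun x => by
        refine Eq.trans ?_ (integral_const_mul c _)
        exact integral_congr_ae (Eventually.of_forall fun z => mul_left_comm _ _ _)))
    1 fun φ ψ => by
      rw [one_mul]
      exact CovFun.norm_conv_le hp hξ φ ψ

/-- `L^p_ξ(G,N)`: the Banach completion of `(𝒞_ξ(G,N), ‖·‖_(p))`. -/
abbrev LpCov (ξ : N →ₜ* Circle) (μ : Measure (G ⧸ N)) [μ.IsHaarMeasure] (p : ℝ≥0∞)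
    [Fact (1 ≤ p)] : Type _ := UniformSpace.Completion (CovFun ξ μ p)

/-- The extension of `♮` to a bounded bilinear map `L^1_ξ(G,N) × L^p_ξ(G,N) → L^p_ξ(G,N)`. -/
def LpCov.conv [Fact (1 ≤ p)] (hp : p ≠ ∞) (hξ : ξ ∈ invariantCharacters N) :
    LpCov ξ μ 1 →L[ℂ] LpCov ξ μ p →L[ℂ] LpCov ξ μ p :=
  ((((UniformSpace.Completion.toComplL.postcomp (CovFun ξ μ p)).comp
    (CovFun.convL hp hξ)).extend UniformSpace.Completion.toComplL).flip.extend
      UniformSpace.Completion.toComplL).flip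

theorem LpCov.conv_coe [Fact (1 ≤ p)] (hp : p ≠ ∞) (hξ : ξ ∈ invariantCharacters N)
    (φ : CovFun ξ μ 1) (ψ : CovFun ξ μ p) :
    LpCov.conv hp hξ (φ : LpCov ξ μ 1) (ψ : LpCov ξ μ p) = (φ.conv hξ ψ : LpCov ξ μ p) := by
  have e1 : ∀ {q : ℝ≥0∞} [Fact (1 ≤ q)],
      DenseRange (UniformSpace.Completion.toComplL (𝕜 := ℂ) (E := CovFun ξ μ q)) :=
    UniformSpace.Completion.denseRange_coe
  have e2 : ∀ {q : ℝ≥0∞} [Fact (1 ≤ q)],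
      IsUniformInducing (UniformSpace.Completion.toComplL (𝕜 := ℂ) (E := CovFun ξ μ q)) :=
    UniformSpace.Completion.isUniformInducing_coe _
  have h1 := ContinuousLinearMap.extend_eq
    (((UniformSpace.Completion.toComplL (𝕜 := ℂ)).postcomp (CovFun ξ μ p)).comp
      (CovFun.convL (μ := μ) hp hξ)) e1 e2 φ
  have h2 := ContinuousLinearMap.extend_eq
    ((((UniformSpace.Completion.toComplL (𝕜 := ℂ)).postcomp (CovFun ξ μ p)).comp
      (CovFun.convL (μ := μ) hp hξ)).extend UniformSpace.Completion.toComplL).flip e1 e2 ψ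
  have h3 := congrArg (fun T => T (φ : LpCov ξ μ 1)) h2
  have h4 := congrArg (fun T => T ψ) h1
  exact h3.trans h4

/-- The function `f` on `G` represents `F ∈ L^p_ξ(G,N)`: it is covariant, and some sequence in
`𝒞_ξ(G,N)` converges to `F` in `L^p_ξ(G,N)` and to `f` in the sense that
`∫_{G/N} |f(y) - u_n(y)|^p dμ(yN) → 0`. -/
def LpCov.Represents [Fact (1 ≤ p)] (f : G → ℂ) (F : LpCov ξ μ p) : Prop :=
  IsCovariant ξ f ∧ ∃ u : ℕ → CovFun ξ μ p,
    Tendsto (fun n => (u n : LpCov ξ μ p)) atTop (𝓝 F) ∧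
    (∀ n, AEStronglyMeasurable (descend N fun x => ‖f x - u n x‖) μ) ∧
    Tendsto (fun n => eLpNorm (descend N fun x => ‖f x - u n x‖) p μ) atTop (𝓝 0)
end Convolution

section Haar

/-- `P` holds locally almost everywhere: the exceptional set meets every compact set in a null
set. -/
def LocallyAE {X : Type*} [TopologicalSpace X] [MeasurableSpace X] (μ : Measure X)
    (P : X → Prop) : Prop :=
  ∀ K : Set X, IsCompact K → μ ({x | ¬ P x} ∩ K) = 0

variable {G : Type*} [Group G] [TopologicalSpace G] [MeasurableSpace G]

/-- Weil's formula `∫_{G/N} ∫_N f(xs) dν(s) dμ(xN) = ∫_G f(x) dlam(x)` for `f ∈ 𝒞_c(G)`. -/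
def WeilFormula {N : Subgroup G} [MeasurableSpace (G ⧸ N)]
    (lam : Measure G) (ν : Measure N) (μ : Measure (G ⧸ N)) : Prop :=
  ∀ f : G → ℂ, Continuous f → HasCompactSupport f →
    ∫ z, descend N (fun x => ∫ s : N, f (x * s) ∂ν) z ∂μ = ∫ x, f x ∂lam

end Haar

end

end CovariantFunctions

/-! Riesz–Fischer on `G ⧸ N`, then dominated convergence. Given representatives of `Φ` and `Ψ` are
almost everywhere limits of sequences `u n`, `v n` in `𝒞_ξ(G,N)` with summable increments. The
majorants `U = |u 0| + ∑ |u (k+1) - u k|` and `V`, formed likewise from `v`, lie in `L^1` and `L^p`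
of `G ⧸ N`. Young's inequality `lintegral_conv_rpow_le` for partial sums, with monotone convergence,
makes `∫ U(z) V(z⁻¹w) dz` finite for almost every `w` (`ae_lintegral_conv_tsum_lt_top`). For such `w
= xN`, `U(z) V(z⁻¹w)` dominates the integrands of `u n ♮ v n (x)`, whence integrability and
convergence to the desired integral (`ae_tendsto_covConv`).

Since `u n ♮ v n` also tends to `Φ ♮ Ψ` in norm, a subsequence tends almost everywhere to any
representative `χ`, and the two limits agree. The exceptional cosets form a null set of `G ⧸ N`,
whose preimage in `G` is locally null by Weil's formula.

No σ-finiteness is assumed. Interchange of integrals is therefore used only for functions in `𝒞_c`,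
and null sets are transported by inversion and by the quotient map only inside compact sets. -/

namespace CovariantFunctions

/-! ### Transport of null sets along continuous maps, inversion and the quotient map. -/

section NullSets

/-- A measure on compact subsets of `X` which is dominated, along a continuous map `f`, by a
multiple of an outer regular measure on `Y` does not charge the preimages of null sets. -/
theorem measure_preimage_inter_eq_zero {X Y : Type*} [TopologicalSpace X] [T2Space X]
    [MeasurableSpace X] [BorelSpace X] [TopologicalSpace Y] [T2Space Y] [LocallyCompactSpace Y]
    [MeasurableSpace Y] [BorelSpace Y] {lam : Measure X} [lam.Regular] {μ : Measure Y}
    [μ.OuterRegular] {f : X → Y} (hf : Continuous f) {K : Set X} (hK : IsCompact K) {C : ℝ≥0∞}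
    (hC : C ≠ ∞)
    (h : ∀ (L : Set X) (g : Y → ℝ), IsCompact L → L ⊆ K → Continuous g → HasCompactSupport g →
      (∀ y, 0 ≤ g y) → (∀ y, g y ≤ 1) → (∀ x ∈ L, g (f x) = 1) →
      lam L ≤ C * ∫⁻ y, ENNReal.ofReal (g y) ∂μ)
    {Z : Set Y} (hZ : μ Z = 0) : lam (f ⁻¹' Z ∩ K) = 0 := by
  -- Testing with Urysohn functions supported in `V`, and inner regularity on a set of finite
  -- measure, turn the bound on integrals into one on open sets. Outer regularity of `μ` then
  -- handles `Z`.
  have hopen : ∀ V : Set Y, IsOpen V → lam (f ⁻¹' V ∩ K) ≤ C * μ V := by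
    intro V hV
    have hmeas : MeasurableSet (f ⁻¹' V ∩ K) := (hV.preimage hf).measurableSet.inter hK.measurableSet
    have hfin : lam (f ⁻¹' V ∩ K) ≠ ∞ :=
      ((measure_mono Set.inter_subset_right).trans_lt hK.measure_lt_top).ne
    rw [hmeas.measure_eq_iSup_isCompact_of_ne_top hfin]
    refine iSup₂_le fun L hL => iSup_le fun hLc => ?_
    obtain ⟨g, hg1, hg0, hgc, hg⟩ := exists_continuous_one_zero_of_isCompact (hLc.image hf)
      hV.isClosed_compl (Set.disjoint_compl_right_iff_subset.2
        (Set.image_subset_iff.2 (hL.trans Set.inter_subset_left)))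
    refine (h L g hLc (hL.trans Set.inter_subset_right) g.continuous hgc (fun y => (hg y).1)
      (fun y => (hg y).2) fun x hx => hg1 (Set.mem_image_of_mem f hx)).trans ?_
    gcongr
    calc ∫⁻ y, ENNReal.ofReal (g y) ∂μ ≤ ∫⁻ y, V.indicator 1 y ∂μ := by
          refine lintegral_mono fun y => ?_
          by_cases hy : y ∈ V
          · simpa [hy] using (hg y).2
          · simpa [hy] using (hg0 hy).le
      _ = μ V := lintegral_indicator_one hV.measurableSet
  refine nonpos_iff_eq_zero.1 (ENNReal.le_of_forall_pos_le_add fun ε hε _ => ?_)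
  -- The `+ 1` avoids division by zero when `C = 0`.
  obtain ⟨V, hZV, hVo, hV⟩ := Z.exists_isOpen_lt_of_lt (ENNReal.ofReal (ε / (C.toReal + 1)))
    (μ := μ) (by rw [hZ]; exact ENNReal.ofReal_pos.2 (by positivity))
  calc lam (f ⁻¹' Z ∩ K) ≤ lam (f ⁻¹' V ∩ K) := by gcongr
    _ ≤ C * μ V := hopen V hVo
    _ ≤ C * ENNReal.ofReal (ε / (C.toReal + 1)) := by gcongr
    _ = ENNReal.ofReal (C.toReal * (ε / (C.toReal + 1))) := by
        rw [ENNReal.ofReal_mul ENNReal.toReal_nonneg, ENNReal.ofReal_toReal hC]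
    _ ≤ ENNReal.ofReal ε := by
        refine ENNReal.ofReal_le_ofReal ?_
        rw [← mul_div_assoc, div_le_iff₀ (by positivity)]
        nlinarith [ENNReal.toReal_nonneg (a := C), NNReal.coe_nonneg ε]
    _ = 0 + ε := by rw [ENNReal.ofReal_coe_nnreal, zero_add]

/-- Inversion preserves local null sets of a Haar measure. -/
theorem measure_inv_preimage_inter_eq_zero {H : Type*} [Group H] [TopologicalSpace H]
    [IsTopologicalGroup H] [LocallyCompactSpace H] [T2Space H] [MeasurableSpace H] [BorelSpace H]
    (μ : Measure H) [μ.IsHaarMeasure] [μ.Regular] {Z : Set H} (hZ : μ Z = 0) {K : Set H}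
    (hK : IsCompact K) : μ ((fun z => z⁻¹) ⁻¹' Z ∩ K) = 0 := by
  obtain ⟨⟨k, kc⟩, k_comp, k_nonneg, k_one⟩ : ∃ k : C(H, ℝ), HasCompactSupport k ∧ 0 ≤ k ∧ k 1 ≠ 0 :=
    exists_continuous_nonneg_pos 1
  obtain ⟨c, hc1, -, hcc, hc⟩ := exists_continuous_one_zero_of_isCompact hK.inv
    isClosed_empty (Set.disjoint_empty _)
  set D : H → ℝ := fun x => ∫ y, k (y⁻¹ * x) ∂μ.inv with hD
  have D_cont : Continuous D := continuous_integral_apply_inv_mul kc k_comp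
  have D_pos : ∀ x, 0 < D x := by
    intro x
    have C : Continuous (fun y ↦ k (y⁻¹ * x)) := by fun_prop
    apply (integral_pos_iff_support_of_nonneg _ _).2
    · apply C.isOpen_support.measure_pos μ.inv
      exact ⟨x * 1⁻¹, by simpa using k_one⟩
    · exact fun y ↦ k_nonneg (y⁻¹ * x)
    · apply C.integrable_of_hasCompactSupport
      exact k_comp.comp_homeomorph ((Homeomorph.inv H).trans (Homeomorph.mulRight x))
  have hI : 0 < ∫ x, k x ∂μ := kc.integral_pos_of_hasCompactSupport_nonneg_nonzero k_comp k_nonneg k_one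
  obtain ⟨M, hM⟩ := hcc.isCompact.exists_bound_of_continuousOn D_cont.continuousOn
  -- Off the support of `c` the product is `0`, while `M` may be negative if that support is empty.
  have hcD : ∀ y, c y * D y ≤ M ⊔ 0 := fun y => by
    by_cases hy : y ∈ tsupport c
    · have := (le_abs_self _).trans (hM y hy)
      calc c y * D y ≤ 1 * D y := by gcongr; exacts [(D_pos y).le, (hc y).2]
        _ ≤ M ⊔ 0 := by rw [one_mul]; exact this.trans le_sup_left
    · simp [image_eq_zero_of_notMem_tsupport hy]
  refine measure_preimage_inter_eq_zero (μ := μ) continuous_inv hK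
    (C := ENNReal.ofReal ((M ⊔ 0) / ∫ x, k x ∂μ)) ENNReal.ofReal_ne_top ?_ hZ
  intro L g hL hLK gc g_comp g0 g1 gL
  -- `D` is bounded only on compact sets. The cutoff `c` confines `g` to such a set, and `c = 1` on
  -- `K⁻¹` keeps all of `L⁻¹`.
  set h : H → ℝ := fun y => g y * c y with hh
  have h_cont : Continuous h := gc.mul c.continuous
  have h_comp : HasCompactSupport h := g_comp.mul_right
  -- Against `𝒞_c` functions the right Haar measure `μ.inv` has density `D / ∫ k` with respect to
  -- `μ`; testing on `h * D` cancels the factor `D⁻¹`.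
  have key := Measure.integral_isMulLeftInvariant_isMulRightInvariant_combo (μ := μ) (ν := μ.inv)
    (h_cont.mul D_cont) h_comp.mul_right kc k_comp k_nonneg k_one
  have e1 : ∀ y, h y * D y * (∫ z, k (z⁻¹ * y) ∂μ.inv)⁻¹ = h y := fun y =>
    mul_inv_cancel_right₀ (D_pos y).ne' _
  simp only [Pi.mul_apply, e1] at key
  have h0 : ∀ y, 0 ≤ h y := fun y => mul_nonneg (g0 y) (hc y).1
  calc μ L = ∫⁻ z, L.indicator 1 z ∂μ := (lintegral_indicator_one hL.measurableSet).symm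
    _ ≤ ∫⁻ z, ENNReal.ofReal (h z⁻¹) ∂μ := by
        refine lintegral_mono fun z => ?_
        by_cases hz : z ∈ L
        · have : c z⁻¹ = 1 := hc1 (by simpa using hLK hz)
          simp [hz, hh, gL z hz, this]
        · simp [hz]
    _ = ∫⁻ z, ENNReal.ofReal (h z) ∂μ.inv := by
        rw [Measure.inv, lintegral_map (by fun_prop) measurable_inv]
    _ = ENNReal.ofReal (∫ z, h z ∂μ.inv) := by
        rw [ofReal_integral_eq_lintegral_ofReal (h_cont.integrable_of_hasCompactSupport h_comp)
          (Eventually.of_forall h0)]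
    _ ≤ ENNReal.ofReal ((M ⊔ 0) / (∫ x, k x ∂μ) * ∫ y, g y ∂μ) := by
        refine ENNReal.ofReal_le_ofReal ?_
        rw [div_mul_eq_mul_div, le_div_iff₀ hI, ← key, ← integral_const_mul]
        refine integral_mono
          ((h_cont.mul D_cont).integrable_of_hasCompactSupport h_comp.mul_right)
          ((gc.integrable_of_hasCompactSupport g_comp).const_mul _) fun y => ?_
        simp only [hh]
        rw [mul_assoc, mul_comm]
        exact mul_le_mul_of_nonneg_right (hcD y) (g0 y)
    _ = _ := by
        rw [ENNReal.ofReal_mul (by positivity), ofReal_integral_eq_lintegral_ofReal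
          (gc.integrable_of_hasCompactSupport g_comp) (Eventually.of_forall g0)]

open scoped Pointwise in
/-- By Weil's formula, the preimage in `G` of a null set of `G ⧸ N` is locally null. -/
theorem WeilFormula.measure_preimage_inter_eq_zero {G : Type*} [Group G] [TopologicalSpace G]
    [IsTopologicalGroup G] [LocallyCompactSpace G] [T2Space G] [MeasurableSpace G] [BorelSpace G]
    {N : Subgroup G} [N.Normal] [IsClosed (N : Set G)]
    [MeasurableSpace (G ⧸ N)] [BorelSpace (G ⧸ N)]
    {lam : Measure G} [lam.IsHaarMeasure] [lam.Regular] {ν : Measure N} [ν.IsHaarMeasure]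
    {μ : Measure (G ⧸ N)} [μ.Regular] (hW : WeilFormula lam ν μ)
    {Z : Set (G ⧸ N)} (hZ : μ Z = 0) {K : Set G} (hK : IsCompact K) :
    lam ((↑) ⁻¹' Z ∩ K) = 0 := by
  obtain ⟨c, hc1, -, hcc, hc⟩ := exists_continuous_one_zero_of_isCompact hK
    isClosed_empty (Set.disjoint_empty _)
  set T : Set N := Subtype.val ⁻¹' ((tsupport c)⁻¹ * tsupport c) with hT
  have hTc : IsCompact T := (Topology.IsClosedEmbedding.isCompact_preimage
    (IsClosed.isClosedEmbedding_subtypeVal ‹IsClosed (N : Set G)›) (hcc.isCompact.inv.mul hcc.isCompact))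
  -- If `x t` lies in the support of `c` for some `t ∈ N`, translation by `t` confines the
  -- integration variable to `T`. Thus `ν T` bounds the integral of `c` over every coset.
  have hbound : ∀ z, ‖descend N (fun x => ∫ s : N, (c (x * s) : ℂ) ∂ν) z‖ₑ ≤ ν T := by
    intro z
    induction z using QuotientGroup.induction_on with | _ x
    rw [descend_mk (F := fun x => ∫ s : N, (c (x * s) : ℂ) ∂ν) (fun x s => by
      have := integral_mul_left_eq_self (μ := ν) (fun t : N => (c (x * t) : ℂ)) s
      simpa [mul_assoc] using this)]
    by_cases hx : ∃ t : N, x * t ∈ tsupport c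
    · obtain ⟨t, ht⟩ := hx
      have := integral_mul_left_eq_self (μ := ν) (fun s : N => (c (x * s) : ℂ)) t
      rw [← this]
      refine (enorm_integral_le_lintegral_enorm _).trans ?_
      rw [← lintegral_indicator_one hTc.measurableSet]
      refine lintegral_mono fun s => ?_
      by_cases hs : s ∈ T
      · simp only [hs, Set.indicator_of_mem, Pi.one_apply]
        rw [← ofReal_norm, Complex.norm_real, Real.norm_of_nonneg (hc _).1]
        simpa using (hc _).2
      · have : x * (t * s : N) ∉ tsupport c := fun h => hs
          ⟨_, Set.inv_mem_inv.2 ht, _, h, by simp [mul_assoc]⟩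
        rw [image_eq_zero_of_notMem_tsupport this]
        simp
    · rw [integral_eq_zero_of_ae]
      · simp
      · refine Eventually.of_forall fun s => ?_
        have : x * s ∉ tsupport c := fun h => hx ⟨s, h⟩
        simp [image_eq_zero_of_notMem_tsupport this]
  refine CovariantFunctions.measure_preimage_inter_eq_zero (f := ((↑) : G → G ⧸ N)) (μ := μ)
    QuotientGroup.continuous_mk hK
    (C := ν T) hTc.measure_lt_top.ne ?_ hZ
  intro L g hL hLK gc g_comp g0 g1 gL
  have hF : Continuous fun x : G => c x * g (x : G ⧸ N) :=
    c.continuous.mul (gc.comp QuotientGroup.continuous_mk)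
  have hFc : HasCompactSupport fun x : G => c x * g (x : G ⧸ N) := hcc.mul_right
  have hF0 : ∀ x : G, 0 ≤ c x * g (x : G ⧸ N) := fun x => mul_nonneg (hc x).1 (g0 _)
  -- As `g` is constant on cosets, the inner integral in Weil's formula is `g` times that of `c`.
  have hw := hW (fun x => ((c x * g (x : G ⧸ N) : ℝ) : ℂ))
    (Complex.continuous_ofReal.comp hF) (hFc.comp_left Complex.ofReal_zero)
  rw [integral_complex_ofReal] at hw
  calc lam L = ∫⁻ z, L.indicator 1 z ∂lam := (lintegral_indicator_one hL.measurableSet).symm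
    _ ≤ ∫⁻ x, ENNReal.ofReal (c x * g (x : G ⧸ N)) ∂lam := by
        refine lintegral_mono fun z => ?_
        by_cases hz : z ∈ L
        · have : c z = 1 := hc1 (hLK hz)
          simp [hz, gL z hz, this]
        · simp [hz]
    _ = ENNReal.ofReal (∫ x, c x * g (x : G ⧸ N) ∂lam) := by
        rw [ofReal_integral_eq_lintegral_ofReal (hF.integrable_of_hasCompactSupport hFc)
          (Eventually.of_forall hF0)]
    _ = ‖((∫ x, c x * g (x : G ⧸ N) ∂lam : ℝ) : ℂ)‖ₑ := by
        rw [← ofReal_norm, Complex.norm_real, Real.norm_of_nonneg (integral_nonneg hF0)]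
    _ ≤ ∫⁻ z, ν T * ENNReal.ofReal (g z) ∂μ := by
        rw [← hw]
        refine (enorm_integral_le_lintegral_enorm _).trans (lintegral_mono fun z => ?_)
        have : descend N (fun x => ∫ s : N, ((c (x * s) * g ((x * s : G) : G ⧸ N) : ℝ) : ℂ) ∂ν) z =
            descend N (fun x => ∫ s : N, (c (x * s) : ℂ) ∂ν) z * g z := by
          simp only [descend]
          rw [← integral_mul_const]
          congr 1
          ext s
          rw [QuotientGroup.mk_mul_of_mem _ s.2, QuotientGroup.out_eq']
          push_cast
          rfl
        rw [this, enorm_mul]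
        gcongr
        · exact hbound z
        · rw [← ofReal_norm, Complex.norm_real, Real.norm_of_nonneg (g0 _)]
    _ = _ := lintegral_const_mul' _ _ hTc.measure_lt_top.ne

end NullSets

/-! ### Convolution of countable sums of `𝒞_c` functions. -/

section Tonelli

theorem iSup_rpow {f : ℕ → ℝ≥0∞} {r : ℝ} (hr : 0 < r) : (⨆ n, f n) ^ r = ⨆ n, f n ^ r :=
  (ENNReal.orderIsoRpow r hr).map_iSup f

theorem iSup_mul_iSup_le_of_monotone {f g : ℕ → ℝ≥0∞} (hf : Monotone f) (hg : Monotone g) :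
    (⨆ n, f n) * (⨆ n, g n) ≤ ⨆ n, f n * g n := by
  rw [ENNReal.iSup_mul]
  refine iSup_le fun i => ?_
  rw [ENNReal.mul_iSup]
  refine iSup_le fun j => le_trans ?_ (le_iSup _ (max i j))
  gcongr
  exacts [hf (le_max_left _ _), hg (le_max_right _ _)]

theorem monotone_sum_range_ofReal {X : Type*} (a : ℕ → X → ℝ) (z : X) :
    Monotone fun n => ∑ k ∈ Finset.range n, ENNReal.ofReal (a k z) := fun _ _ h =>
  Finset.sum_le_sum_of_subset (Finset.range_mono h)

variable {G : Type*} [Group G] [TopologicalSpace G] [IsTopologicalGroup G]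
  {N : Subgroup G} [N.Normal]
  [MeasurableSpace (G ⧸ N)] [BorelSpace (G ⧸ N)] {μ : Measure (G ⧸ N)} [μ.IsHaarMeasure]

/-- Supplies measurability in `w` of the convolutions of partial sums, in place of Tonelli's theorem
on the product. The integration runs over the fixed compact support of `a`, so continuity passes
under the integral. -/
theorem continuous_lintegral_conv {a b : G ⧸ N → ℝ} (ha : Continuous a) (hb : Continuous b)
    (ha' : HasCompactSupport a) (ha0 : ∀ z, 0 ≤ a z) (hb0 : ∀ z, 0 ≤ b z) :
    Continuous fun w => ∫⁻ z, ENNReal.ofReal (a z) * ENNReal.ofReal (b (z⁻¹ * w)) ∂μ := by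
  have hf : Continuous (Function.uncurry fun w z : G ⧸ N => a z * b (z⁻¹ * w)) :=
    (ha.comp continuous_snd).mul (hb.comp (continuous_snd.inv.mul continuous_fst))
  have hI : Continuous fun w => ∫ z, a z * b (z⁻¹ * w) ∂μ := by
    rw [← continuousOn_univ]
    refine continuousOn_integral_of_compact_support
      (f := fun w z => a z * b (z⁻¹ * w)) ha'.isCompact hf.continuousOn ?_
    intro w z _ hz
    rw [image_eq_zero_of_notMem_tsupport hz, zero_mul]
  convert ENNReal.continuous_ofReal.comp hI using 2 with w
  have hint : Integrable (fun z => a z * b (z⁻¹ * w)) μ :=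
    (hf.comp (Continuous.prodMk_right w)).integrable_of_hasCompactSupport
      (ha'.mono fun z hz h => hz (by simp [h]))
  rw [Function.comp, ofReal_integral_eq_lintegral_ofReal hint
    (Eventually.of_forall fun z => mul_nonneg (ha0 z) (hb0 _))]
  simp only [ENNReal.ofReal_mul (ha0 _)]

variable [IsClosed (N : Set G)]

/-- For countable sums `A`, `B` of nonnegative functions in `𝒞_c(G/N)` with `A` integrable and
`B` in `L^r`, the convolution of `A` and `B` is finite almost everywhere. -/
theorem ae_lintegral_conv_tsum_lt_top {a b : ℕ → G ⧸ N → ℝ} (ha : ∀ k, Continuous (a k))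
    (hb : ∀ k, Continuous (b k)) (ha' : ∀ k, HasCompactSupport (a k))
    (hb' : ∀ k, HasCompactSupport (b k)) (ha0 : ∀ k z, 0 ≤ a k z) (hb0 : ∀ k z, 0 ≤ b k z)
    {r : ℝ} (hr : 1 ≤ r) (hA : ∫⁻ z, ∑' k, ENNReal.ofReal (a k z) ∂μ ≠ ∞)
    (hB : ∫⁻ z, (∑' k, ENNReal.ofReal (b k z)) ^ r ∂μ ≠ ∞) :
    ∀ᵐ w ∂μ, ∫⁻ z, (∑' k, ENNReal.ofReal (a k z)) * ∑' k, ENNReal.ofReal (b k (z⁻¹ * w)) ∂μ < ∞ := by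
  have hr0 : 0 < r := zero_lt_one.trans_le hr
  have sum_cont : ∀ {c : ℕ → G ⧸ N → ℝ}, (∀ k, Continuous (c k)) → ∀ n : ℕ,
      Continuous fun z => ∑ k ∈ Finset.range n, c k z := fun hc n =>
    continuous_finsetSum _ fun k _ => hc k
  have sum_comp : ∀ {c : ℕ → G ⧸ N → ℝ}, (∀ k, HasCompactSupport (c k)) → ∀ n : ℕ,
      HasCompactSupport fun z => ∑ k ∈ Finset.range n, c k z := by
    intro c hc n
    induction n with
    | zero =>
      simp only [Finset.range_zero, Finset.sum_empty]
      exact HasCompactSupport.zero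
    | succ n ih =>
      simp only [Finset.sum_range_succ]
      exact ih.add (hc n)
  have sum_nonneg : ∀ {c : ℕ → G ⧸ N → ℝ}, (∀ k z, 0 ≤ c k z) → ∀ (n : ℕ) z,
      0 ≤ ∑ k ∈ Finset.range n, c k z := fun hc n z => Finset.sum_nonneg fun k _ => hc k z
  have sum_ofReal : ∀ {c : ℕ → G ⧸ N → ℝ}, (∀ k z, 0 ≤ c k z) → ∀ (n : ℕ) z,
      ENNReal.ofReal (∑ k ∈ Finset.range n, c k z) =
        ∑ k ∈ Finset.range n, ENNReal.ofReal (c k z) := fun hc n z =>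
    ENNReal.ofReal_sum_of_nonneg fun k _ => hc k z
  set T : ℕ → G ⧸ N → ℝ≥0∞ := fun n w => ∫⁻ z, (∑ k ∈ Finset.range n, ENNReal.ofReal (a k z)) *
    ∑ k ∈ Finset.range n, ENNReal.ofReal (b k (z⁻¹ * w)) ∂μ with hT
  have T_cont : ∀ n, Continuous (T n) := fun n => by
    have := continuous_lintegral_conv (μ := μ) (sum_cont ha n) (sum_cont hb n) (sum_comp ha' n)
      (sum_nonneg ha0 n) (sum_nonneg hb0 n)
    simpa only [sum_ofReal ha0, sum_ofReal hb0] using this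
  have T_mono : Monotone T := fun m n hmn w => lintegral_mono fun z =>
    mul_le_mul' (monotone_sum_range_ofReal a z hmn) (monotone_sum_range_ofReal b _ hmn)
  -- Young's inequality for partial sums, with a bound independent of `n`, so that it survives
  -- monotone convergence.
  have T_le : ∀ n, ∫⁻ w, T n w ^ r ∂μ ≤ (∫⁻ z, ∑' k, ENNReal.ofReal (a k z) ∂μ) ^ r *
      ∫⁻ z, (∑' k, ENNReal.ofReal (b k z)) ^ r ∂μ := fun n => by
    have := lintegral_conv_rpow_le (μ := μ) (sum_cont ha n) (sum_cont hb n) (sum_comp ha' n)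
      (sum_comp hb' n) (sum_nonneg ha0 n) (sum_nonneg hb0 n) hr
    simp only [sum_ofReal ha0, sum_ofReal hb0] at this
    refine this.trans ?_
    gcongr <;> exact ENNReal.sum_le_tsum _
  have hfin : ∫⁻ w, (⨆ n, T n w) ^ r ∂μ ≠ ∞ := by
    simp only [iSup_rpow hr0]
    rw [lintegral_iSup (fun n => (T_cont n).measurable.pow_const r)
      fun m n hmn w => ENNReal.rpow_le_rpow (T_mono hmn w) hr0.le]
    exact ((iSup_le T_le).trans_lt (ENNReal.mul_lt_top (ENNReal.rpow_lt_top_of_nonneg hr0.le hA)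
      hB.lt_top)).ne
  have hmeas : Measurable fun w => (⨆ n, T n w) ^ r :=
    (Measurable.iSup fun n => (T_cont n).measurable).pow_const r
  filter_upwards [ae_lt_top hmeas hfin] with w hw
  refine lt_of_le_of_lt ?_ ((ENNReal.rpow_lt_top_iff_of_pos hr0).1 hw)
  have hle : ∀ z, (∑' k, ENNReal.ofReal (a k z)) * ∑' k, ENNReal.ofReal (b k (z⁻¹ * w)) ≤
      ⨆ n, (∑ k ∈ Finset.range n, ENNReal.ofReal (a k z)) *
        ∑ k ∈ Finset.range n, ENNReal.ofReal (b k (z⁻¹ * w)) := fun z => by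
    rw [ENNReal.tsum_eq_iSup_nat, ENNReal.tsum_eq_iSup_nat]
    exact iSup_mul_iSup_le_of_monotone (monotone_sum_range_ofReal a z)
      (monotone_sum_range_ofReal b _)
  refine (lintegral_mono hle).trans (le_of_eq ?_)
  refine lintegral_iSup (fun n => ?_) fun m n hmn z =>
    mul_le_mul' (monotone_sum_range_ofReal a z hmn) (monotone_sum_range_ofReal b _ hmn)
  refine Measurable.mul (Finset.measurable_fun_sum _ fun k _ => ?_)
    (Finset.measurable_fun_sum _ fun k _ => ?_)
  · exact ENNReal.measurable_ofReal.comp (ha k).measurable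
  · exact ENNReal.measurable_ofReal.comp
      ((hb k).comp (continuous_inv.mul continuous_const)).measurable

end Tonelli

/-! ### Majorants of sequences with summable increments. -/

section Majorant

variable {G : Type*} [Group G] [TopologicalSpace G] [IsTopologicalGroup G]
  {N : Subgroup G} [N.Normal] [IsClosed (N : Set G)]
  [MeasurableSpace (G ⧸ N)] {ξ : N →ₜ* Circle} {μ : Measure (G ⧸ N)} {p : ℝ≥0∞}

namespace CovFun

/-- The increments `u_0, u_1 - u_0, u_2 - u_1, …` of a sequence. -/
def increment (u : ℕ → CovFun ξ μ p) : ℕ → CovFun ξ μ p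
  | 0 => u 0
  | n + 1 => u (n + 1) - u n

theorem sum_increment (u : ℕ → CovFun ξ μ p) (n : ℕ) :
    ∑ k ∈ Finset.range (n + 1), increment u k = u n := by
  induction n with
  | zero => simp [increment]
  | succ n ih => rw [Finset.sum_range_succ, ih]; simp [increment]

theorem sub_apply (φ ψ : CovFun ξ μ p) (x : G) : (φ - ψ) x = φ x - ψ x := rfl

theorem sum_apply {ι : Type*} (s : Finset ι) (f : ι → CovFun ξ μ p) (x : G) :
    (∑ i ∈ s, f i : CovFun ξ μ p) x = ∑ i ∈ s, f i x := by
  classical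
  induction s using Finset.induction_on with
  | empty => rfl
  | insert i s hi ih => rw [Finset.sum_insert hi, Finset.sum_insert hi, ← ih]; rfl

/-- The sum `|u_0| + |u_1 - u_0| + |u_2 - u_1| + …` as a function on `G ⧸ N`. -/
noncomputable def majorant (u : ℕ → CovFun ξ μ p) (z : G ⧸ N) : ℝ≥0∞ :=
  ∑' k, ENNReal.ofReal (absQ (increment u k) z)

/-- Telescoping: `u n` is the sum of its first `n + 1` increments. -/
theorem ofReal_absQ_le_majorant (u : ℕ → CovFun ξ μ p) (n : ℕ) (z : G ⧸ N) :
    ENNReal.ofReal (absQ (u n) z) ≤ majorant u z := by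
  refine le_trans ?_ (ENNReal.sum_le_tsum (Finset.range (n + 1)))
  rw [← ENNReal.ofReal_sum_of_nonneg fun k _ => absQ_nonneg _ _]
  refine ENNReal.ofReal_le_ofReal ?_
  induction z using QuotientGroup.induction_on with | _ x
  simp only [absQ_mk]
  rw [← sum_increment u n, sum_apply]
  exact norm_sum_le _ _

theorem exists_tendsto_of_majorant_ne_top {u : ℕ → CovFun ξ μ p} {x : G}
    (h : majorant u (x : G ⧸ N) ≠ ∞) : ∃ l, Tendsto (fun n => u n x) atTop (𝓝 l) := by
  simp only [majorant, absQ_mk] at h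
  have hs : Summable fun k => increment u k x := by
    refine Summable.of_norm ((ENNReal.summable_toReal h).congr fun k => ?_)
    exact ENNReal.toReal_ofReal (norm_nonneg _)
  refine ⟨_, (hs.hasSum.tendsto_sum_nat.comp (tendsto_add_atTop_nat 1)).congr fun n => ?_⟩
  rw [Function.comp, ← sum_apply, sum_increment]

variable [BorelSpace (G ⧸ N)]

theorem measurable_majorant (u : ℕ → CovFun ξ μ p) : Measurable (majorant u) :=
  Measurable.tsum fun _ =>
    ENNReal.measurable_ofReal.comp (continuous_absQ _).measurable

variable [μ.IsHaarMeasure]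

theorem eLpNorm_absQ (ψ : CovFun ξ μ p) : eLpNorm (absQ ψ) p μ = ENNReal.ofReal ‖ψ‖ := by
  rw [norm_def, ENNReal.ofReal_toReal (ψ.memLp p).eLpNorm_ne_top]

variable [Fact (1 ≤ p)]

/-- Minkowski's inequality bounds the partial sums by the sum of the norms of the increments;
monotone convergence passes to the full series. -/
theorem lintegral_majorant_rpow_ne_top (hp : p ≠ ∞) {u : ℕ → CovFun ξ μ p}
    (hu : Summable fun n => ‖u (n + 1) - u n‖) :
    ∫⁻ z, majorant u z ^ p.toReal ∂μ ≠ ∞ := by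
  have h1p : 1 ≤ p := Fact.out
  have hp0 : p ≠ 0 := (zero_lt_one.trans_le h1p).ne'
  have hr0 : 0 < p.toReal := ENNReal.toReal_pos hp0 hp
  have hs : Summable fun n => ‖increment u n‖ := (summable_nat_add_iff 1).1 hu
  have hle : ∀ n : ℕ, ∫⁻ z, (∑ k ∈ Finset.range n, ENNReal.ofReal (absQ (increment u k) z)) ^
      p.toReal ∂μ ≤ ENNReal.ofReal (∑' k, ‖increment u k‖) ^ p.toReal := by
    intro n
    have h := eLpNorm_sum_le (f := fun k => absQ (increment u k)) (s := Finset.range n) (μ := μ)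
      (fun k _ => ((increment u k).memLp p).aestronglyMeasurable) h1p
    simp only [eLpNorm_absQ] at h
    rw [← ENNReal.ofReal_sum_of_nonneg fun k _ => norm_nonneg _] at h
    replace h := h.trans (ENNReal.ofReal_le_ofReal (hs.sum_le_tsum _ fun k _ => norm_nonneg _))
    rw [eLpNorm_eq_lintegral_rpow_enorm_toReal hp0 hp, one_div, ENNReal.rpow_inv_le_iff hr0] at h
    refine le_trans (le_of_eq ?_) h
    congr 1
    ext z
    rw [Finset.sum_apply, Real.enorm_of_nonneg (Finset.sum_nonneg fun k _ => absQ_nonneg _ _),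
      ENNReal.ofReal_sum_of_nonneg fun k _ => absQ_nonneg _ _]
  simp only [majorant, ENNReal.tsum_eq_iSup_nat, iSup_rpow hr0]
  rw [lintegral_iSup]
  · exact ((iSup_le hle).trans_lt (ENNReal.rpow_lt_top_of_nonneg hr0.le ENNReal.ofReal_ne_top)).ne
  · exact fun n => (Finset.measurable_fun_sum _ fun k _ =>
      ENNReal.measurable_ofReal.comp (continuous_absQ _).measurable).pow_const _
  · exact fun m n hmn z => ENNReal.rpow_le_rpow (monotone_sum_range_ofReal _ z hmn) hr0.le

theorem ae_majorant_lt_top (hp : p ≠ ∞) {u : ℕ → CovFun ξ μ p}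
    (hu : Summable fun n => ‖u (n + 1) - u n‖) : ∀ᵐ z ∂μ, majorant u z < ∞ := by
  have hp0 : p ≠ 0 := (zero_lt_one.trans_le (Fact.out : 1 ≤ p)).ne'
  filter_upwards [ae_lt_top ((measurable_majorant u).pow_const _)
    (lintegral_majorant_rpow_ne_top hp hu)] with z hz
  exact (ENNReal.rpow_lt_top_iff_of_pos (ENNReal.toReal_pos hp0 hp)).1 hz

end CovFun

end Majorant

/-! ### Dominated convergence for the covariant convolution. -/

section Limits

variable {G : Type*} [Group G] [TopologicalSpace G] [IsTopologicalGroup G]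
  {N : Subgroup G} [N.Normal] [IsClosed (N : Set G)]
  [MeasurableSpace (G ⧸ N)] {ξ : N →ₜ* Circle} {μ : Measure (G ⧸ N)} {p : ℝ≥0∞}

theorem descend_norm_sub_mk {f : G → ℂ} (hf : IsCovariant ξ f) (u : CovFun ξ μ p) (x : G) :
    descend N (fun x => ‖f x - u x‖) (x : G ⧸ N) = ‖f x - u x‖ :=
  descend_mk (F := fun x => ‖f x - u x‖) (fun x s => by
    rw [hf, u.isCovariant, ← mul_sub, norm_mul, Circle.norm_coe, one_mul]) x

variable [BorelSpace (G ⧸ N)] [μ.IsHaarMeasure] [Fact (1 ≤ p)]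

open CovFun

/-- A null set of `G ⧸ N` meets almost every `z⁻¹ w` with `z` in the support of a majorant only in
a null set. -/
theorem ae_majorant_ne_zero_imp_notMem [LocallyCompactSpace G] [μ.Regular] {q : ℝ≥0∞}
    (u : ℕ → CovFun ξ μ q) {Z : Set (G ⧸ N)} (hZ : μ Z = 0) (w : G ⧸ N) :
    ∀ᵐ z ∂μ, majorant u z ≠ 0 → z⁻¹ * w ∉ Z := by
  have hk : ∀ k, ∀ᵐ z ∂μ, z ∈ ((↑) '' tsupport (increment u k) : Set (G ⧸ N)) → z⁻¹ * w ∉ Z := by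
    intro k
    have hK := (increment u k).isCompact
    -- The bad set is `w Z⁻¹`. Left translation by `w⁻¹` reduces it to `Z⁻¹`, which is known to be
    -- null only inside compact sets; hence one support at a time, of which there are countably
    -- many.
    have h0 := measure_inv_preimage_inter_eq_zero μ hZ
      (hK.image (continuous_const_mul w⁻¹))
    rw [← measure_preimage_mul μ w⁻¹] at h0
    refine measure_mono_null (fun z hz => ?_) h0
    simp only [Set.mem_compl_iff, Set.mem_ofPred_eq, Classical.not_imp, not_not] at hz
    refine ⟨?_, z, hz.1, rfl⟩
    simpa using hz.2
  filter_upwards [ae_all_iff.2 hk] with z hz hne hmem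
  refine hne (ENNReal.tsum_eq_zero.2 fun k => ?_)
  rw [absQ_eq_zero _ fun h => hz k h hmem, ENNReal.ofReal_zero]

/-- If `u_n → φ` and `v_n → ψ` almost everywhere, with summable increments in `L^1_ξ` and `L^p_ξ`,
then `u_n ♮ v_n → φ ♮ ψ` almost everywhere. -/
theorem ae_tendsto_covConv [LocallyCompactSpace G] [μ.Regular] (hp : p ≠ ∞)
    (hξ : ξ ∈ invariantCharacters N) {φ ψ : G → ℂ}
    {u : ℕ → CovFun ξ μ 1} {v : ℕ → CovFun ξ μ p} (hu : Summable fun n => ‖u (n + 1) - u n‖)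
    (hv : Summable fun n => ‖v (n + 1) - v n‖)
    (huφ : ∀ᵐ z ∂μ, ∀ y : G, (y : G ⧸ N) = z → Tendsto (fun n => u n y) atTop (𝓝 (φ y)))
    (hvψ : ∀ᵐ z ∂μ, ∀ y : G, (y : G ⧸ N) = z → Tendsto (fun n => v n y) atTop (𝓝 (ψ y))) :
    ∀ᵐ w ∂μ, ∀ x : G, (x : G ⧸ N) = w →
      Integrable (descend N fun y => φ y * ψ (y⁻¹ * x)) μ ∧
      Tendsto (fun n => covConv μ (u n) (v n) x) atTop
        (𝓝 (∫ z, descend N (fun y => φ y * ψ (y⁻¹ * x)) z ∂μ)) := by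
  have h1 : ∫⁻ z, majorant u z ∂μ ≠ ∞ := by
    simpa using lintegral_majorant_rpow_ne_top ENNReal.one_ne_top hu
  have h1p : 1 ≤ p.toReal := by
    rw [← ENNReal.toReal_one]; exact ENNReal.toReal_mono hp Fact.out
  filter_upwards [ae_lintegral_conv_tsum_lt_top (μ := μ) (fun k => (increment u k).continuous_absQ)
    (fun k => (increment v k).continuous_absQ) (fun k => (increment u k).hasCompactSupport_absQ)
    (fun k => (increment v k).hasCompactSupport_absQ) (fun k => (increment u k).absQ_nonneg)
    (fun k => (increment v k).absQ_nonneg) h1p h1 (lintegral_majorant_rpow_ne_top hp hv)]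
    with w hw x hx
  change ∫⁻ z, majorant u z * majorant v (z⁻¹ * w) ∂μ < ∞ at hw
  have hmeas : Measurable fun z => majorant u z * majorant v (z⁻¹ * w) :=
    (measurable_majorant u).mul ((measurable_majorant v).comp
      (continuous_inv.mul continuous_const).measurable)
  have hbound : ∀ᵐ z ∂μ, ∀ n, ‖descend N (fun y => u n y * v n (y⁻¹ * x)) z‖ ≤
      (majorant u z * majorant v (z⁻¹ * w)).toReal := by
    filter_upwards [ae_lt_top hmeas hw.ne] with z hz n
    rw [norm_integrand, hx]
    rw [← ENNReal.ofReal_le_iff_le_toReal hz.ne, ENNReal.ofReal_mul (absQ_nonneg _ _)]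
    exact mul_le_mul' (ofReal_absQ_le_majorant u n z) (ofReal_absQ_le_majorant v n _)
  have hlim : ∀ᵐ z ∂μ, Tendsto (fun n => descend N (fun y => u n y * v n (y⁻¹ * x)) z) atTop
      (𝓝 (descend N (fun y => φ y * ψ (y⁻¹ * x)) z)) := by
    filter_upwards [huφ, ae_majorant_ne_zero_imp_notMem u hvψ w] with z hz1 hz2
    have hφz := hz1 z.out (QuotientGroup.out_eq' z)
    -- Where `U` vanishes, so do all `u n` and their limit `φ`, so the behaviour of `v n` is
    -- irrelevant. Elsewhere `z⁻¹ w` avoids the bad set of `v`.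
    by_cases hz : majorant u z = 0
    · have h0 : ∀ n, u n z.out = 0 := fun n => by
        have := ofReal_absQ_le_majorant u n z
        rw [hz, nonpos_iff_eq_zero, ENNReal.ofReal_eq_zero] at this
        exact norm_eq_zero.1 (le_antisymm this (absQ_nonneg _ _))
      have h1 : φ z.out = 0 := by
        refine tendsto_nhds_unique hφz ?_
        simp only [h0]
        exact tendsto_const_nhds
      simp [descend, h0, h1]
    · have := hz2 hz
      simp only [Set.mem_compl_iff, Set.mem_ofPred_eq, not_not] at this
      -- `z.out⁻¹ * x` is an arbitrary representative of `z⁻¹ w`: this is why convergence is assumed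
      -- at every point of almost every coset.
      refine hφz.mul (this (z.out⁻¹ * x) ?_)
      rw [QuotientGroup.mk_mul, QuotientGroup.mk_inv, QuotientGroup.out_eq', hx]
  have hbi := integrable_toReal_of_lintegral_ne_top hmeas.aemeasurable hw.ne
  have hFm : ∀ n, AEStronglyMeasurable (descend N fun y => u n y * v n (y⁻¹ * x)) μ := fun n =>
    (integrable_integrand hξ (u n) (v n) x).aestronglyMeasurable
  refine ⟨hbi.mono' (aestronglyMeasurable_of_tendsto_ae atTop hFm hlim) ?_,
    tendsto_integral_of_dominated_convergence _ hFm hbi (fun n => ?_) hlim⟩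
  · filter_upwards [hbound, hlim] with z hz hz'
    exact le_of_tendsto hz'.norm (Eventually.of_forall hz)
  · filter_upwards [hbound] with z hz using hz n

/-! ### Representing functions as almost everywhere limits. -/

theorem LpCov.norm_sub_eq (φ ψ : CovFun ξ μ p) :
    ‖(φ : LpCov ξ μ p) - (ψ : LpCov ξ μ p)‖ = ‖φ - ψ‖ := by
  rw [← UniformSpace.Completion.coe_sub, UniformSpace.Completion.norm_coe]

theorem summable_norm_sub_of_dist_lt {F : LpCov ξ μ p} {u : ℕ → CovFun ξ μ p}
    (hu : ∀ n, dist (u n : LpCov ξ μ p) F < (1 / 2) ^ n) :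
    Summable fun n => ‖u (n + 1) - u n‖ := by
  refine Summable.of_nonneg_of_le (fun n => norm_nonneg _) (fun n => ?_)
    (summable_geometric_two.mul_left 2)
  rw [← LpCov.norm_sub_eq, ← dist_eq_norm]
  refine (dist_triangle_right _ _ F).trans ?_
  have h1 := hu n
  have h2 := hu (n + 1)
  rw [pow_succ] at h2
  have : (0 : ℝ) < (1 / 2) ^ n := by positivity
  linarith

/-- Every element of `L^p_ξ(G,N)` is represented by a function on `G`. -/
theorem LpCov.exists_represents (hp : p ≠ ∞) (F : LpCov ξ μ p) :
    ∃ f : G → ℂ, LpCov.Represents f F := by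
  classical
  have hd : ∀ n : ℕ, ∃ u : CovFun ξ μ p, dist (u : LpCov ξ μ p) F < (1 / 2) ^ n := fun n => by
    obtain ⟨u, hu⟩ := UniformSpace.Completion.denseRange_coe.exists_dist_lt F
      (show (0 : ℝ) < (1 / 2) ^ n by positivity)
    exact ⟨u, by rwa [dist_comm]⟩
  choose u hu using hd
  have hlim : ∀ x : G, majorant u (x : G ⧸ N) ≠ ∞ → ∃ l, Tendsto (fun n => u n x) atTop (𝓝 l) :=
    fun x => exists_tendsto_of_majorant_ne_top
  have huF : Tendsto (fun n => (u n : LpCov ξ μ p)) atTop (𝓝 F) := by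
    rw [tendsto_iff_dist_tendsto_zero]
    exact squeeze_zero (fun n => dist_nonneg) (fun n => (hu n).le)
      (tendsto_pow_atTop_nhds_zero_of_lt_one (by norm_num) (by norm_num))
  -- The majorant is infinite on a union of cosets, so the default value `0` there keeps `f`
  -- covariant.
  set f : G → ℂ := fun x => if h : majorant u (x : G ⧸ N) ≠ ∞ then (hlim x h).choose else 0 with hf
  have f_lim : ∀ x : G, majorant u (x : G ⧸ N) ≠ ∞ → Tendsto (fun n => u n x) atTop (𝓝 (f x)) := by
    intro x h
    simp only [hf, dif_pos h]
    exact (hlim x h).choose_spec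
  have f_cov : IsCovariant ξ f := by
    intro x s
    have hxs : ((x * s : G) : G ⧸ N) = x := QuotientGroup.mk_mul_of_mem x s.2
    by_cases h : majorant u (x : G ⧸ N) = ∞
    · simp [hf, h, hxs]
    · refine tendsto_nhds_unique (f_lim (x * s) (by rwa [hxs])) ?_
      simp only [(u _).isCovariant x s]
      exact (f_lim x h).const_mul _
  have hae : ∀ n, ∀ᵐ z ∂μ, Tendsto (fun m => absQ (u m - u n) z) atTop
      (𝓝 (descend N (fun x => ‖f x - u n x‖) z)) := by
    intro n
    filter_upwards [ae_majorant_lt_top hp (summable_norm_sub_of_dist_lt hu)] with z hz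
    refine ((f_lim z.out ?_).sub_const (u n z.out)).norm
    rw [QuotientGroup.out_eq']
    exact hz.ne
  have hmeas : ∀ n m, AEStronglyMeasurable (absQ (u m - u n)) μ := fun n m =>
    ((u m - u n).memLp p).aestronglyMeasurable
  refine ⟨f, f_cov, u, huF, fun n => aestronglyMeasurable_of_tendsto_ae atTop (hmeas n) (hae n), ?_⟩
  have hle : ∀ n, eLpNorm (descend N fun x => ‖f x - u n x‖) p μ ≤
      ENNReal.ofReal (2 * (1 / 2) ^ n) := by
    intro n
    -- Fatou in `m`: for `m ≥ n` both `u m` and `u n` are within `(1/2)^n` of `F`, whence the factor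
    -- `2`.
    refine (Lp.eLpNorm_lim_le_liminf_eLpNorm (hmeas n) _ (hae n)).trans ?_
    refine liminf_le_of_frequently_le' (Eventually.frequently ?_)
    filter_upwards [eventually_ge_atTop n] with m hm
    rw [eLpNorm_absQ]
    refine ENNReal.ofReal_le_ofReal ?_
    rw [← LpCov.norm_sub_eq, ← dist_eq_norm]
    refine (dist_triangle_right _ _ F).trans ?_
    have h1 := hu n
    have h2 := hu m
    have h3 : ((1 : ℝ) / 2) ^ m ≤ (1 / 2) ^ n :=
      pow_le_pow_of_le_one (by norm_num) (by norm_num) hm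
    linarith
  refine tendsto_of_tendsto_of_tendsto_of_le_of_le tendsto_const_nhds ?_ (fun _ => zero_le) hle
  have := ENNReal.tendsto_ofReal
    ((tendsto_pow_atTop_nhds_zero_of_lt_one (r := (1 / 2 : ℝ)) (by norm_num)
      (by norm_num)).const_mul 2)
  simpa using this

/-- A sequence of nonnegative functions tending to zero in `L^p` has a subsequence tending to zero
almost everywhere. -/
theorem exists_subseq_ae_tendsto_zero {X : Type*} [MeasurableSpace X] {m : Measure X}
    {h : ℕ → X → ℝ} (hm : ∀ n, AEStronglyMeasurable (h n) m)
    (h0 : Tendsto (fun n => eLpNorm (h n) p m) atTop (𝓝 0)) :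
    ∃ ns : ℕ → ℕ, StrictMono ns ∧ ∀ᵐ z ∂m, Tendsto (fun i => h (ns i) z) atTop (𝓝 0) :=
  (tendstoInMeasure_of_tendsto_eLpNorm (g := 0) (zero_lt_one.trans_le (Fact.out : 1 ≤ p)).ne' hm
    aestronglyMeasurable_const (by simpa only [sub_zero] using h0)).exists_seq_tendsto_ae

/-- Every sequence in `𝒞_ξ(G,N)` with limit `F` has a subsequence that converges almost everywhere
to a given function representing `F`. -/
theorem LpCov.Represents.exists_subseq_ae_tendsto {f : G → ℂ} {F : LpCov ξ μ p}
    (hf : LpCov.Represents f F) {c : ℕ → CovFun ξ μ p}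
    (hc : Tendsto (fun n => (c n : LpCov ξ μ p)) atTop (𝓝 F)) :
    ∃ ns : ℕ → ℕ, StrictMono ns ∧ ∀ᵐ z ∂μ, ∀ y : G, (y : G ⧸ N) = z →
      Tendsto (fun n => c (ns n) y) atTop (𝓝 (f y)) := by
  obtain ⟨hcov, u, huF, hum, hu0⟩ := hf
  have hd : Tendsto (fun n => eLpNorm (absQ (u n - c n)) p μ) atTop (𝓝 0) := by
    have h1 := (huF.sub hc).norm
    simp only [LpCov.norm_sub_eq, sub_self, norm_zero] at h1
    simpa only [eLpNorm_absQ, ENNReal.ofReal_zero] using ENNReal.tendsto_ofReal h1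
  have hm : ∀ n, AEStronglyMeasurable (absQ (u n - c n)) μ := fun n =>
    ((u n - c n).memLp p).aestronglyMeasurable
  -- `|f - c n| ≤ |f - u n| + |u n - c n|`, and the right side tends to zero in `L^p`, so one
  -- extraction serves both terms.
  obtain ⟨ns, hns, hae⟩ := exists_subseq_ae_tendsto_zero (p := p) (fun n => (hum n).add (hm n))
    (tendsto_of_tendsto_of_tendsto_of_le_of_le tendsto_const_nhds
      (by simpa using hu0.add hd) (fun _ => zero_le)
      fun n => eLpNorm_add_le (hum n) (hm n) Fact.out)
  refine ⟨ns, hns, ?_⟩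
  filter_upwards [hae] with z hz y hy
  subst hy
  simp only [Pi.add_apply, descend_norm_sub_mk hcov, absQ_mk, CovFun.sub_apply] at hz
  rw [tendsto_iff_norm_sub_tendsto_zero]
  refine squeeze_zero (fun n => norm_nonneg _) (fun n => ?_) hz
  rw [norm_sub_rev]
  exact norm_sub_le_norm_sub_add_norm_sub _ _ _

/-- A representing function is the almost everywhere limit of a sequence in `𝒞_ξ(G,N)` with
summable increments. -/
theorem LpCov.Represents.exists_ae_tendsto {f : G → ℂ} {F : LpCov ξ μ p}
    (hf : LpCov.Represents f F) : ∃ u : ℕ → CovFun ξ μ p,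
      Tendsto (fun n => (u n : LpCov ξ μ p)) atTop (𝓝 F) ∧
      (Summable fun n => ‖u (n + 1) - u n‖) ∧
      ∀ᵐ z ∂μ, ∀ y : G, (y : G ⧸ N) = z → Tendsto (fun n => u n y) atTop (𝓝 (f y)) := by
  obtain ⟨u, huF⟩ : ∃ u : ℕ → CovFun ξ μ p, Tendsto (fun n => (u n : LpCov ξ μ p)) atTop (𝓝 F) :=
    ⟨hf.2.choose, hf.2.choose_spec.1⟩
  obtain ⟨ns, hns, hae⟩ := hf.exists_subseq_ae_tendsto huF
  have hev : ∀ n : ℕ, ∀ᶠ k in atTop, dist (u (ns k) : LpCov ξ μ p) F < (1 / 2) ^ n := fun n =>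
    (tendsto_iff_dist_tendsto_zero.1 (huF.comp hns.tendsto_atTop)).eventually_lt_const
      (by positivity)
  -- A second extraction forces geometric convergence in norm, hence summable increments, and keeps
  -- the pointwise limits.
  obtain ⟨σ, hσ, hσd⟩ := extraction_forall_of_eventually hev
  have h1 : Tendsto (fun n => (u (ns (σ n)) : LpCov ξ μ p)) atTop (𝓝 F) :=
    huF.comp (hns.comp hσ).tendsto_atTop
  have h2 := summable_norm_sub_of_dist_lt (u := fun n => u (ns (σ n))) hσd
  refine ⟨fun n => u (ns (σ n)), h1, h2, ?_⟩
  filter_upwards [hae] with z hz y hy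
  exact (hz y hy).comp hσ.tendsto_atTop

theorem LpCov.tendsto_coe_conv (hp : p ≠ ∞) (hξ : ξ ∈ invariantCharacters N) {Φ : LpCov ξ μ 1}
    {Ψ : LpCov ξ μ p} {u : ℕ → CovFun ξ μ 1} {v : ℕ → CovFun ξ μ p}
    (hu : Tendsto (fun n => (u n : LpCov ξ μ 1)) atTop (𝓝 Φ))
    (hv : Tendsto (fun n => (v n : LpCov ξ μ p)) atTop (𝓝 Ψ)) :
    Tendsto (fun n => ((u n).conv hξ (v n) : LpCov ξ μ p)) atTop (𝓝 (LpCov.conv hp hξ Φ Ψ)) := by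
  have hcont : Continuous fun w : LpCov ξ μ 1 × LpCov ξ μ p => LpCov.conv hp hξ w.1 w.2 :=
    ContinuousLinearMap.continuous₂ _
  have hlim := hcont.tendsto (Φ, Ψ)
  have h := hlim.comp (hu.prodMk_nhds hv)
  refine h.congr fun n => ?_
  exact LpCov.conv_coe hp hξ (u n) (v n)

end Limits

end CovariantFunctions

/-! ### The theorem on representing functions of `Φ ♮ Ψ`. -/

open CovariantFunctions in
theorem mainTheorem5 {G : Type*} [Group G] [TopologicalSpace G] [IsTopologicalGroup G]
    [LocallyCompactSpace G] [T2Space G] [MeasurableSpace G] [BorelSpace G]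
    {N : Subgroup G} [N.Normal] [IsClosed (N : Set G)]
    [MeasurableSpace (G ⧸ N)] [BorelSpace (G ⧸ N)]
    (lamG : Measure G) [lamG.IsHaarMeasure] [lamG.Regular]
    (lamN : Measure N) [lamN.IsHaarMeasure] [lamN.Regular]
    (lamQ : Measure (G ⧸ N)) [lamQ.IsHaarMeasure] [lamQ.Regular]
    (hWeil : CovariantFunctions.WeilFormula lamG lamN lamQ)
    (ξ : N →ₜ* Circle) (hξ : ξ ∈ CovariantFunctions.invariantCharacters N)
    (p : ℝ≥0∞) [Fact (1 ≤ p)] (hp : p ≠ ∞)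
    (Φ : CovariantFunctions.LpCov ξ lamQ 1) (Ψ : CovariantFunctions.LpCov ξ lamQ p) :
    (∃ φ : G → ℂ, CovariantFunctions.LpCov.Represents φ Φ) ∧
    (∃ ψ : G → ℂ, CovariantFunctions.LpCov.Represents ψ Ψ) ∧
    (∃ χ : G → ℂ, CovariantFunctions.LpCov.Represents χ
      (CovariantFunctions.LpCov.conv hp hξ Φ Ψ)) ∧
    ∀ φ ψ χ : G → ℂ, CovariantFunctions.LpCov.Represents φ Φ →
      CovariantFunctions.LpCov.Represents ψ Ψ →
      CovariantFunctions.LpCov.Represents χ (CovariantFunctions.LpCov.conv hp hξ Φ Ψ) →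
      CovariantFunctions.LocallyAE lamG fun x =>
        Integrable (CovariantFunctions.descend N fun y => φ y * ψ (y⁻¹ * x)) lamQ ∧
        χ x = ∫ z, CovariantFunctions.descend N (fun y => φ y * ψ (y⁻¹ * x)) z ∂lamQ := by
  refine ⟨LpCov.exists_represents ENNReal.one_ne_top Φ, LpCov.exists_represents hp Ψ,
    LpCov.exists_represents hp _, fun φ ψ χ hφ hψ hχ K hK => ?_⟩
  obtain ⟨u, huΦ, hus, huφ⟩ := hφ.exists_ae_tendsto
  obtain ⟨v, hvΨ, hvs, hvψ⟩ := hψ.exists_ae_tendsto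
  have hconv := LpCov.tendsto_coe_conv hp hξ huΦ hvΨ
  -- Only a subsequence reaches `χ`, but the whole sequence converges to the integral, so the limits
  -- can be compared.
  obtain ⟨ns, hns, hχae⟩ := hχ.exists_subseq_ae_tendsto hconv
  have hae : ∀ᵐ w ∂lamQ, ∀ x : G, (x : G ⧸ N) = w →
      Integrable (descend N fun y => φ y * ψ (y⁻¹ * x)) lamQ ∧
        χ x = ∫ z, descend N (fun y => φ y * ψ (y⁻¹ * x)) z ∂lamQ := by
    filter_upwards [hχae, ae_tendsto_covConv hp hξ hus hvs huφ hvψ] with w h1 h2 x hx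
    exact ⟨(h2 x hx).1, tendsto_nhds_unique (h1 x hx) ((h2 x hx).2.comp hns.tendsto_atTop)⟩
  refine measure_mono_null ?_ (hWeil.measure_preimage_inter_eq_zero (ae_iff.1 hae) hK)
  rintro x ⟨hx, hxK⟩
  exact ⟨fun h => hx (h x rfl), hxK⟩
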